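/- Let $M\ge 2$ and let $F=\{f_1,\dots,f_N\}\subseteq\mathbb{R}^M$ be a real $M\times N$ unit norm frame, i.e., $\|f_i\|=1$ for every $i$ and there exist $0<A\le B<\infty$ such that $A\|x\|^2\le\sum_{i=1}^N|\langle x,f_i\rangle|^2\le B\|x\|^2$ for every $x\in\mathbb{R}^M$. Then its worst-case coherence $\mu_F:=\max_{i\ne j}|\langle f_i,f_j\rangle|$ satisfies $$\mu_F\ \ge\ \cos\left[\pi\left(\frac{M-1}{N\pi^{1/2}}\,\frac{\Gamma(\frac{M-1}{2})}{\Gamma(\frac{M}{2})}\right)^{\frac{1}{M-1}}\right].$$ Furthermore, for every real $a>0$ and every choice of nonnegative integers $N=N(M)$ with $N(M)=\Theta(a^M)$ as $M\to\infty$ (i.e., there are constants $c,C>0$ and $M_0$ such that $c\,a^M\le N(M)\le C\,a^M$ for all $M>M_0$), the right-hand side of this inequality, with $N=N(M)$, converges to $\cos(\pi/a)$ as $M\to\infty$. -/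

import Mathlib

open Filter Topology Asymptotics

noncomputable section

/-- A finite family `F` of vectors in a real inner product space is a frame if there are frame
bounds `0 < A ≤ B < ∞` with `A ‖x‖² ≤ ∑ i, |⟪x, F i⟫|² ≤ B ‖x‖²` for every `x`. -/
def IsFrame {ι E : Type*} [Fintype ι] [NormedAddCommGroup E] [InnerProductSpace ℝ E]
    (F : ι → E) : Prop :=
  ∃ A B : ℝ, 0 < A ∧ A ≤ B ∧
    ∀ x : E, A * ‖x‖ ^ 2 ≤ ∑ i, |inner ℝ x (F i)| ^ 2 ∧
      ∑ i, |inner ℝ x (F i)| ^ 2 ≤ B * ‖x‖ ^ 2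

/-- A unit norm frame: a frame all of whose elements have norm one. -/
def IsUnitNormFrame {ι E : Type*} [Fintype ι] [NormedAddCommGroup E] [InnerProductSpace ℝ E]
    (F : ι → E) : Prop :=
  IsFrame F ∧ ∀ i, ‖F i‖ = 1

/-- Worst-case coherence: the maximum of `|⟪F i, F j⟫|` over all pairs of distinct indices.
The supremum is over a finite index set, which is nonempty when there are at least two indices,
so it is a maximum. -/
def worstCaseCoherence {ι E : Type*} [Fintype ι] [NormedAddCommGroup E] [InnerProductSpace ℝ E]
    (F : ι → E) : ℝ :=
  ⨆ p : {p : ι × ι // p.1 ≠ p.2}, |inner ℝ (F p.1.1) (F p.1.2)|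

/-- The quantity
`cos [π ((M - 1) / (N π^(1/2)) * Γ((M - 1) / 2) / Γ(M / 2)) ^ (1 / (M - 1))]`,
computed in the real numbers. -/
def coherenceBound (M N : ℕ) : ℝ :=
  Real.cos (Real.pi *
    (((M : ℝ) - 1) / ((N : ℝ) * Real.sqrt Real.pi) *
      (Real.Gamma (((M : ℝ) - 1) / 2) / Real.Gamma ((M : ℝ) / 2))) ^ (1 / ((M : ℝ) - 1)))

end

/-! With θ = arccos μ_F, the 2N vectors ±f_i are pairwise at angle at least θ, so the caps of
angular radius θ/2 around them are disjoint. Put n = M - 2 and let w be the integral of sin^n over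
[0, π]. Comparing volumes of the cones over the caps with the ball (`card_mul_integral_sin_pow_le`)
gives 2N ∫_0^{θ/2} sin^n ≤ w. Jordan's inequality sin φ ≥ 2φ/π (`le_integral_sin_pow`) turns this
into (θ/π)^(n+1) ≤ (n+1)w/(Nπ), and w is a Gamma quotient (`integral_sin_pow_eq_Gamma`). Taking
roots and cosines gives the bound.

For the limit, 1/(n+1) ≤ w ≤ π, so every factor except N ≍ a^M disappears under the (n+1)-th root.
-/

/-! ### Volumes of sectors of the unit ball -/

open MeasureTheory Set Module in
/-- Integration of a radial function in terms of the unit ball and a one-dimensional integral. -/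
lemma lintegral_fun_norm_addHaar {E : Type*} [NormedAddCommGroup E] [NormedSpace ℝ E]
    [Nontrivial E] [FiniteDimensional ℝ E] [MeasurableSpace E] [BorelSpace E]
    (μ : Measure E) [μ.IsAddHaarMeasure] {f : ℝ → ENNReal} (hf : Measurable f) :
    ∫⁻ x, f ‖x‖ ∂μ = μ.toSphere univ *
      ∫⁻ y in Ioi (0 : ℝ), ENNReal.ofReal (y ^ (finrank ℝ E - 1)) * f y := by
  calc
    ∫⁻ x, f ‖x‖ ∂μ = ∫⁻ x : ({(0)}ᶜ : Set E), f (‖x.1‖) ∂(μ.comap (↑)) := by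
      rw [lintegral_subtype_comap (measurableSet_singleton _).compl fun x ↦ f (‖x‖),
        restrict_compl_singleton]
    _ = ∫⁻ x, f x.2 ∂μ.toSphere.prod (.volumeIoiPow (finrank ℝ E - 1)) := by
      simpa using μ.measurePreserving_homeomorphUnitSphereProd.lintegral_comp_emb
        (Homeomorph.measurableEmbedding _) (f ∘ Subtype.val ∘ Prod.snd)
    _ = μ.toSphere univ * ∫⁻ x : Ioi (0 : ℝ), f x ∂.volumeIoiPow (finrank ℝ E - 1) := by
      rw [lintegral_prod _ (by fun_prop)]
      simp [mul_comm]
    _ = _ := by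
      rw [Measure.volumeIoiPow, lintegral_withDensity_eq_lintegral_mul _ (by fun_prop)
        (by fun_prop)]
      simp only [Pi.mul_apply]
      rw [lintegral_subtype_comap measurableSet_Ioi fun a : ℝ ↦
        ENNReal.ofReal (a ^ (finrank ℝ E - 1)) * f a]

/-- The part of the open unit ball lying within angle `r` of `v`. -/
def ballSector {V : Type*} [NormedAddCommGroup V] [InnerProductSpace ℝ V] (v : V) (r : ℝ) :
    Set V :=
  {x | ‖x‖ < 1 ∧ InnerProductGeometry.angle x v < r}

lemma measurableSet_ballSector {V : Type*} [NormedAddCommGroup V] [InnerProductSpace ℝ V]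
    [MeasurableSpace V] [BorelSpace V] (v : V) (r : ℝ) :
    MeasurableSet (ballSector v r) := by
  have h1 : Measurable fun x : V => inner ℝ x v := by
    have : Continuous fun x : V => inner ℝ x v := by fun_prop
    exact this.measurable
  have h2 : Measurable fun x : V => InnerProductGeometry.angle x v := by
    unfold InnerProductGeometry.angle
    exact Real.continuous_arccos.measurable.comp (h1.div (measurable_norm.mul_const _))
  exact (measurableSet_lt measurable_norm measurable_const).inter
    (measurableSet_lt h2 measurable_const)

open MeasureTheory in
lemma volume_ballSector_map {V W : Type*} [NormedAddCommGroup V] [InnerProductSpace ℝ V]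
    [FiniteDimensional ℝ V] [MeasurableSpace V] [BorelSpace V]
    [NormedAddCommGroup W] [InnerProductSpace ℝ W]
    [FiniteDimensional ℝ W] [MeasurableSpace W] [BorelSpace W]
    (T : V ≃ₗᵢ[ℝ] W) (v : V) (r : ℝ) :
    volume (ballSector (T v) r) = volume (ballSector v r) := by
  rw [← T.measurePreserving.measure_preimage (measurableSet_ballSector _ _).nullMeasurableSet]
  congr 1
  ext x
  simp [ballSector, InnerProductGeometry.angle]

-- An isometry of the spaces carries v to a vector of the same norm as w, and a reflection then
-- carries that vector to w.
open MeasureTheory in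
lemma volume_ballSector_congr {V W : Type*} [NormedAddCommGroup V] [InnerProductSpace ℝ V]
    [FiniteDimensional ℝ V] [MeasurableSpace V] [BorelSpace V]
    [NormedAddCommGroup W] [InnerProductSpace ℝ W]
    [FiniteDimensional ℝ W] [MeasurableSpace W] [BorelSpace W]
    (h : Module.finrank ℝ V = Module.finrank ℝ W) {v : V} {w : W} (hvw : ‖v‖ = ‖w‖) (r : ℝ) :
    volume (ballSector v r) = volume (ballSector w r) := by
  let T : V ≃ₗᵢ[ℝ] W := ((stdOrthonormalBasis ℝ V).reindex (finCongr h)).equiv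
    (stdOrthonormalBasis ℝ W) (Equiv.refl _)
  rw [← volume_ballSector_map T v, ← volume_ballSector_map (ℝ ∙ (T v - w))ᗮ.reflection (T v),
    Submodule.reflection_sub (by simpa using hvw)]

open MeasureTheory Set Module in
/-- The volume of a sector of the unit ball is proportional to an integral of a power of `sin`. -/
lemma exists_volume_ballSector_prod_eq {F : Type*} [NormedAddCommGroup F] [InnerProductSpace ℝ F]
    [FiniteDimensional ℝ F] [Nontrivial F] [MeasurableSpace F] [BorelSpace F] :
    ∃ K : ENNReal, ∀ r : ℝ,
      volume (ballSector (WithLp.toLp 2 ((1 : ℝ), (0 : F))) r) =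
        K * ∫⁻ φ in Ioo 0 (min r Real.pi), ENNReal.ofReal (Real.sin φ ^ (finrank ℝ F - 1)) := by
  set n := finrank ℝ F - 1 with hn
  let S : Measure F := volume
  refine ⟨S.toSphere univ * ∫⁻ ρ in Ioo (0 : ℝ) 1, ENNReal.ofReal (ρ * ρ ^ n), fun r => ?_⟩
  -- The profile of the sector in the coordinates (position along the axis, distance to the axis).
  let G : Set (ℝ × ℝ) := {p | √(p.1 ^ 2 + p.2 ^ 2) < 1 ∧
    Real.arccos (p.1 / √(p.1 ^ 2 + p.2 ^ 2)) < r}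
  have hsq : Measurable fun p : ℝ × ℝ => √(p.1 ^ 2 + p.2 ^ 2) := by fun_prop
  have hG : MeasurableSet G :=
    (measurableSet_lt hsq measurable_const).inter
      (measurableSet_lt (Real.continuous_arccos.measurable.comp (measurable_fst.div hsq))
        measurable_const)
  let g : ℝ × ℝ → ENNReal := G.indicator 1
  have hg : Measurable g := measurable_one.indicator hG
  -- Extending by zero to the whole plane makes planar polar coordinates available.
  let h : ℝ × ℝ → ENNReal := fun p => (Ioi 0).indicator (fun s => ENNReal.ofReal (s ^ n)) p.2 * g p
  have hh : Measurable h := by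
    refine Measurable.mul ?_ hg
    exact (Measurable.indicator (by fun_prop) measurableSet_Ioi).comp measurable_snd
  have step1 : volume (ballSector (WithLp.toLp 2 ((1 : ℝ), (0 : F))) r) =
      ∫⁻ t : ℝ, ∫⁻ y : F, g (t, ‖y‖) := by
    rw [← (WithLp.volume_preserving_toLp ℝ F).measure_preimage
      (measurableSet_ballSector _ _).nullMeasurableSet,
      ← lintegral_indicator_one ((WithLp.volume_preserving_toLp ℝ F).measurable
        (measurableSet_ballSector _ _)), Measure.volume_eq_prod, lintegral_prod]
    · congr 1; ext t; congr 1; ext y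
      simp only [g, G, indicator, ballSector, InnerProductGeometry.angle, mem_preimage,
        WithLp.prod_norm_eq_of_L2, WithLp.prod_inner_apply]
      simp
    · refine (Measurable.indicator measurable_one ?_).aemeasurable
      exact (WithLp.volume_preserving_toLp ℝ F).measurable (measurableSet_ballSector _ _)
  have step2 : ∫⁻ t : ℝ, ∫⁻ y : F, g (t, ‖y‖) = S.toSphere univ * ∫⁻ p, h p := by
    rw [Measure.volume_eq_prod, lintegral_prod _ hh.aemeasurable, ← lintegral_const_mul _ hh.lintegral_prod_right']
    congr 1; ext t
    rw [lintegral_fun_norm_addHaar S (f := fun s => g (t, s)) (by fun_prop),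
      ← lintegral_indicator measurableSet_Ioi]
    congr 2; ext s
    by_cases hs : 0 < s <;> simp [h, hs, hn]
  let a : ℝ → ENNReal := (Ioo (0 : ℝ) 1).indicator fun ρ => ENNReal.ofReal (ρ * ρ ^ n)
  let b : ℝ → ENNReal := (Ioo (0 : ℝ) (min r Real.pi)).indicator
    fun φ => ENNReal.ofReal (Real.sin φ ^ n)
  have ha : Measurable a := Measurable.indicator (by fun_prop) measurableSet_Ioo
  have hb : Measurable b := Measurable.indicator (by fun_prop) measurableSet_Ioo
  -- With distance to the axis ρ sin φ, the density times the Jacobian is ρ · ρ^n · sin^n φ, which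
  -- separates; only 0 < φ < π contributes.
  have step3 : ∫⁻ p, h p = ∫⁻ p : ℝ × ℝ, a p.1 * b p.2 := by
    rw [← lintegral_comp_polarCoord_symm,
      ← lintegral_indicator polarCoord.open_target.measurableSet]
    congr 1; ext ⟨ρ, φ⟩
    by_cases hp : (ρ, φ) ∈ polarCoord.target
    · have hp' := hp
      simp only [polarCoord_target, mem_prod, mem_Ioi, mem_Ioo] at hp'
      obtain ⟨hρ, hφ1, hφ2⟩ := hp'
      have e1 : (ρ * Real.cos φ) ^ 2 + (ρ * Real.sin φ) ^ 2 = ρ ^ 2 := by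
        linear_combination ρ ^ 2 * Real.sin_sq_add_cos_sq φ
      rw [indicator_of_mem hp]
      simp only [h, g, G, polarCoord_symm_apply, indicator, mem_Ioi, mem_ofPred_eq, e1,
        Real.sqrt_sq hρ.le, mul_div_cancel_left₀ _ hρ.ne', a, b, mem_Ioo, Pi.one_apply, hρ,
        true_and, lt_min_iff]
      by_cases hφ : 0 < φ
      · rw [Real.arccos_cos hφ.le hφ2.le]
        have hs := Real.sin_pos_of_pos_of_lt_pi hφ hφ2
        simp only [hρ, hs, mul_pos, hφ, hφ2, if_true, true_and, and_true]
        by_cases h1 : ρ < 1 <;> by_cases h2 : φ < r <;> simp [h1, h2]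
        rw [← ENNReal.ofReal_mul hρ.le, ← ENNReal.ofReal_mul (by positivity), mul_pow, mul_assoc]
      · have hs := Real.sin_nonpos_of_nonpos_of_neg_pi_le (not_lt.1 hφ) hφ1.le
        have : ¬ 0 < ρ * Real.sin φ := not_lt.2 (mul_nonpos_of_nonneg_of_nonpos hρ.le hs)
        simp [this, hφ]
    · rw [indicator_of_notMem hp]
      symm
      by_contra hne
      obtain ⟨h1, h2⟩ := mul_ne_zero_iff.1 hne
      have h1 := mem_of_indicator_ne_zero h1
      have h2 := mem_of_indicator_ne_zero h2
      refine hp ?_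
      simp only [polarCoord_target, mem_prod, mem_Ioi, mem_Ioo, lt_min_iff] at h1 h2 ⊢
      exact ⟨h1.1, by linarith [Real.pi_pos], h2.2.2⟩
  rw [step1, step2, step3, Measure.volume_eq_prod,
    lintegral_prod_mul ha.aemeasurable hb.aemeasurable,
    lintegral_indicator measurableSet_Ioo, lintegral_indicator measurableSet_Ioo, mul_assoc]

open MeasureTheory Set in
lemma lintegral_sin_pow (n : ℕ) {r : ℝ} (h0 : 0 ≤ r) (hr : r ≤ Real.pi) :
    ∫⁻ φ in Ioo 0 r, ENNReal.ofReal (Real.sin φ ^ n) =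
      ENNReal.ofReal (∫ φ in (0 : ℝ)..r, Real.sin φ ^ n) := by
  rw [intervalIntegral.integral_of_le h0, integral_Ioc_eq_integral_Ioo,
    ofReal_integral_eq_lintegral_ofReal]
  · exact ((Real.continuous_sin.pow n).integrableOn_Icc).mono_set Ioo_subset_Icc_self
  · filter_upwards [ae_restrict_mem measurableSet_Ioo] with φ hφ
    exact pow_nonneg (Real.sin_nonneg_of_nonneg_of_le_pi hφ.1.le (hφ.2.le.trans hr)) n

/-! ### Packing of caps -/

/-- Triangle inequality for angles; the strict inequality in the sector allows equality in the
hypothesis. -/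
lemma disjoint_ballSector {V : Type*} [NormedAddCommGroup V] [InnerProductSpace ℝ V] {v w : V}
    {r : ℝ} (h : 2 * r ≤ InnerProductGeometry.angle v w) :
    Disjoint (ballSector v r) (ballSector w r) := by
  rw [Set.disjoint_left]
  rintro x ⟨-, h1⟩ ⟨-, h2⟩
  have := InnerProductGeometry.angle_le_angle_add_angle v x w
  rw [InnerProductGeometry.angle_comm v x] at this
  linarith

open MeasureTheory Module in
/-- The spherical cap packing bound: unit vectors in dimension `n + 2` whose pairwise angles are
at least `2 * r` are at most as many as the ratio of the areas of the sphere and of a cap of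
angular radius `r`. -/
lemma card_mul_integral_sin_pow_le {V : Type*} [NormedAddCommGroup V] [InnerProductSpace ℝ V]
    [FiniteDimensional ℝ V] {n : ℕ} (hV : finrank ℝ V = n + 2) {ι : Type*} [Fintype ι] {u : ι → V}
    (hu : ∀ i, ‖u i‖ = 1) {r : ℝ} (h0 : 0 ≤ r) (hr : r ≤ Real.pi)
    (hsep : ∀ i j, i ≠ j → 2 * r ≤ InnerProductGeometry.angle (u i) (u j)) :
    Fintype.card ι * ∫ φ in (0 : ℝ)..r, Real.sin φ ^ n ≤
      ∫ φ in (0 : ℝ)..Real.pi, Real.sin φ ^ n := by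
  borelize V
  have : Nontrivial V := Module.nontrivial_of_finrank_pos (R := ℝ) (by omega)
  let F := EuclideanSpace ℝ (Fin (n + 1))
  obtain ⟨K, hK⟩ := exists_volume_ballSector_prod_eq (F := F)
  have hF : finrank ℝ F - 1 = n := by simp [F]
  have hdim : finrank ℝ V = finrank ℝ (WithLp 2 (ℝ × F)) := by
    rw [hV, (WithLp.linearEquiv 2 ℝ (ℝ × F)).finrank_eq]
    simp [F]
    omega
  have hvol : ∀ v : V, ‖v‖ = 1 → ∀ s : ℝ, volume (ballSector v s) =
      K * ∫⁻ φ in Set.Ioo 0 (min s Real.pi), ENNReal.ofReal (Real.sin φ ^ n) := by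
    intro v hv s
    rw [volume_ballSector_congr hdim (w := WithLp.toLp 2 ((1 : ℝ), (0 : F))) (by simp [hv]), hK, hF]
  have hball : volume (Metric.ball (0 : V) 1) =
      K * ENNReal.ofReal (∫ φ in (0 : ℝ)..Real.pi, Real.sin φ ^ n) := by
    obtain ⟨v, hv⟩ := exists_norm_eq V zero_le_one
    rw [← lintegral_sin_pow n Real.pi_pos.le le_rfl]
    -- Any radius above π yields the whole ball, including the direction opposite to v.
    have := hvol v hv (Real.pi + 1)
    rw [min_eq_right (by linarith)] at this
    rw [← this]
    congr 1
    ext x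
    simpa [ballSector] using fun _ =>
      (InnerProductGeometry.angle_le_pi x v).trans_lt (lt_add_one _)
  -- The ball has positive finite volume, so K can be cancelled without being computed.
  have hK0 : K ≠ 0 := by
    rintro rfl
    rw [zero_mul] at hball
    exact (Metric.measure_ball_pos volume (0 : V) one_pos).ne' hball
  have hKtop : K ≠ ⊤ := by
    rintro rfl
    rw [ENNReal.top_mul (by simpa using integral_sin_pow_pos n)] at hball
    exact measure_ball_lt_top.ne hball
  have hnn : 0 ≤ ∫ φ in (0 : ℝ)..r, Real.sin φ ^ n :=
    intervalIntegral.integral_nonneg h0 fun x hx =>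
      pow_nonneg (Real.sin_nonneg_of_nonneg_of_le_pi hx.1 (hx.2.trans hr)) n
  have hsum : ∑ i, volume (ballSector (u i) r) ≤ volume (Metric.ball (0 : V) 1) := by
    rw [← tsum_fintype (L := .unconditional ι)]
    refine (tsum_meas_le_meas_iUnion_of_disjoint _ (fun i => measurableSet_ballSector _ _)
      fun i j hij => disjoint_ballSector (hsep i j hij)).trans (measure_mono ?_)
    exact Set.iUnion_subset fun i x hx => by simpa using hx.1
  simp only [hvol _ (hu _), min_eq_left hr, lintegral_sin_pow n h0 hr, Finset.sum_const,
    Finset.card_univ, hball, nsmul_eq_mul] at hsum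
  rw [mul_left_comm, ENNReal.mul_le_mul_iff_right hK0 hKtop, ← ENNReal.ofReal_natCast,
    ← ENNReal.ofReal_mul (by positivity),
    ENNReal.ofReal_le_ofReal_iff (integral_sin_pow_pos n).le] at hsum
  exact hsum

/-! ### Integrals of powers of the sine -/

/-- Jordan's inequality sin φ ≥ 2φ/π on [0, π/2], integrated. -/
lemma le_integral_sin_pow (n : ℕ) {r : ℝ} (h0 : 0 ≤ r) (hr : r ≤ Real.pi / 2) :
    (2 / Real.pi) ^ n * (r ^ (n + 1) / (n + 1)) ≤ ∫ φ in (0 : ℝ)..r, Real.sin φ ^ n := by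
  have : ∫ φ in (0 : ℝ)..r, (2 / Real.pi * φ) ^ n = (2 / Real.pi) ^ n * (r ^ (n + 1) / (n + 1)) := by
    simp [mul_pow]
  rw [← this]
  refine intervalIntegral.integral_mono_on h0 ?_ ?_ fun x hx => ?_
  · exact Continuous.intervalIntegrable (by fun_prop) _ _
  · exact Continuous.intervalIntegrable (by fun_prop) _ _
  · have := hx.1
    gcongr
    exact Real.mul_le_sin hx.1 (hx.2.trans hr)

/-- The Wallis integrals in terms of the Gamma function. -/
lemma integral_sin_pow_eq_Gamma (n : ℕ) :
    ∫ φ in (0 : ℝ)..Real.pi, Real.sin φ ^ n =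
      √Real.pi * (Real.Gamma (((n : ℝ) + 1) / 2) / Real.Gamma (((n : ℝ) + 2) / 2)) := by
  induction n using Nat.twoStepInduction with
  | zero =>
    simp [-one_div, Real.Gamma_one_half_eq, Real.pi_pos.le]
  | one =>
    have h : ((1 : ℝ) + 2) / 2 = 1 / 2 + 1 := by norm_num
    simp only [pow_one, integral_sin, Nat.cast_one, h]
    rw [Real.Gamma_add_one (by norm_num), Real.Gamma_one_half_eq]
    have : √Real.pi ≠ 0 := (Real.sqrt_pos.2 Real.pi_pos).ne'
    norm_num
    field_simp
  | more n ih _ =>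
    -- Both sides are multiplied by (n+1)/(n+2) when n increases by 2.
    rw [integral_sin_pow, ih]
    have h1 : (((n + 2 : ℕ) : ℝ) + 1) / 2 = ((n : ℝ) + 1) / 2 + 1 := by push_cast; ring
    have h2 : (((n + 2 : ℕ) : ℝ) + 2) / 2 = ((n : ℝ) + 2) / 2 + 1 := by push_cast; ring
    have := Real.Gamma_pos_of_pos (s := ((n : ℝ) + 2) / 2) (by positivity)
    rw [h1, h2, Real.Gamma_add_one (by positivity), Real.Gamma_add_one (by positivity)]
    simp
    field_simp

lemma integral_sin_pow_le_pi (n : ℕ) : ∫ φ in (0 : ℝ)..Real.pi, Real.sin φ ^ n ≤ Real.pi := by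
  simpa using integral_sin_pow_antitone (Nat.zero_le n)

/-- The Jordan bound at π/2 equals (π/2)/(n+1). A polynomial lower bound is all the limit needs. -/
lemma one_div_add_one_le_integral_sin_pow (n : ℕ) :
    1 / ((n : ℝ) + 1) ≤ ∫ φ in (0 : ℝ)..Real.pi, Real.sin φ ^ n := by
  have hpi := Real.pi_pos
  have h1 := le_integral_sin_pow n (r := Real.pi / 2) (by positivity) le_rfl
  have h2 : (2 / Real.pi) ^ n * ((Real.pi / 2) ^ (n + 1) / (n + 1)) = Real.pi / 2 * (1 / (n + 1)) := by
    rw [pow_succ, div_pow, div_pow]; field_simp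
  have h3 : ∫ φ in (0 : ℝ)..(Real.pi / 2), Real.sin φ ^ n ≤
      ∫ φ in (0 : ℝ)..Real.pi, Real.sin φ ^ n := by
    refine intervalIntegral.integral_mono_interval le_rfl (by positivity) (by linarith) ?_
      (Continuous.intervalIntegrable (by fun_prop) _ _)
    filter_upwards [MeasureTheory.ae_restrict_mem measurableSet_Ioc] with φ hφ
    exact pow_nonneg (Real.sin_nonneg_of_nonneg_of_le_pi hφ.1.le hφ.2) n
  have h4 : (1 : ℝ) * (1 / (n + 1)) ≤ Real.pi / 2 * (1 / (n + 1)) := by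
    gcongr
    linarith [Real.two_le_pi]
  linarith

lemma coherenceBound_add_two (n N : ℕ) :
    coherenceBound (n + 2) N = Real.cos (Real.pi * (((n : ℝ) + 1) / (N * Real.pi) *
      ∫ φ in (0 : ℝ)..Real.pi, Real.sin φ ^ n) ^ (1 / ((n : ℝ) + 1))) := by
  have h : (((n + 2 : ℕ) : ℝ) - 1) = n + 1 := by push_cast; ring
  have h' : ((n + 2 : ℕ) : ℝ) = n + 2 := by push_cast; ring
  have hpi : (N : ℝ) * Real.pi = N * (√Real.pi * √Real.pi) := by
    rw [Real.mul_self_sqrt Real.pi_pos.le]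
  have hs : √Real.pi ≠ 0 := (Real.sqrt_pos.2 Real.pi_pos).ne'
  rw [coherenceBound, h, h', integral_sin_pow_eq_Gamma, hpi]
  congr 3
  field_simp

/-! ### The coherence bound -/

/-- A frame has at least as many elements as the dimension of the space. -/
lemma IsFrame.finrank_le_card {ι E : Type*} [Fintype ι] [NormedAddCommGroup E]
    [InnerProductSpace ℝ E] [FiniteDimensional ℝ E] {F : ι → E} (hF : IsFrame F) :
    Module.finrank ℝ E ≤ Fintype.card ι := by
  obtain ⟨A, B, hA, -, hF⟩ := hF
  let T : E →ₗ[ℝ] ι → ℝ := LinearMap.pi fun i => (innerₗ E (F i))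
  have hT : Function.Injective T := by
    rw [injective_iff_map_eq_zero]
    intro x hx
    have h0 : ∀ i, inner ℝ x (F i) = 0 := fun i => by
      rw [real_inner_comm]
      exact congrFun hx i
    have := (hF x).1
    simp only [h0] at this
    simp only [abs_zero, ne_eq, OfNat.ofNat_ne_zero, not_false_eq_true, zero_pow,
      Finset.sum_const_zero] at this
    have : ‖x‖ ^ 2 ≤ 0 := by
      by_contra! h
      linarith [mul_pos hA h]
    simpa using le_antisymm this (sq_nonneg _)
  simpa using LinearMap.finrank_le_finrank_of_injective hT

lemma abs_inner_le_worstCaseCoherence {ι E : Type*} [Fintype ι] [NormedAddCommGroup E]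
    [InnerProductSpace ℝ E] (F : ι → E) {i j : ι} (hij : i ≠ j) :
    |inner ℝ (F i) (F j)| ≤ worstCaseCoherence F :=
  le_ciSup (f := fun p : {p : ι × ι // p.1 ≠ p.2} => |inner ℝ (F p.1.1) (F p.1.2)|)
    (Set.finite_range _).bddAbove ⟨(i, j), hij⟩

lemma worstCaseCoherence_nonneg {ι E : Type*} [Fintype ι] [NormedAddCommGroup E]
    [InnerProductSpace ℝ E] (F : ι → E) : 0 ≤ worstCaseCoherence F :=
  Real.iSup_nonneg fun _ => abs_nonneg _

/-- The antipodally symmetric system `± F i` is separated by the angle `arccos μ`. -/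
lemma arccos_worstCaseCoherence_le_angle {ι E : Type*} [Fintype ι] [NormedAddCommGroup E]
    [InnerProductSpace ℝ E] {F : ι → E} (hF : ∀ i, ‖F i‖ = 1) (p q : ι × Bool) (hpq : p ≠ q) :
    Real.arccos (worstCaseCoherence F) ≤
      InnerProductGeometry.angle (cond p.2 (F p.1) (-F p.1)) (cond q.2 (F q.1) (-F q.1)) := by
  obtain ⟨i, s⟩ := p
  obtain ⟨j, t⟩ := q
  by_cases hij : i = j
  -- Equal indices force opposite signs, hence antipodal vectors.
  · subst hij
    have h0 : F i ≠ 0 := fun h => by simpa [h] using hF i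
    have : InnerProductGeometry.angle (cond s (F i) (-F i)) (cond t (F i) (-F i)) = Real.pi := by
      cases s <;> cases t <;>
        simp_all [InnerProductGeometry.angle_self_neg_of_nonzero,
          InnerProductGeometry.angle_neg_self_of_nonzero]
    simpa [this] using Real.arccos_le_pi _
  · have h := abs_le.1 (abs_inner_le_worstCaseCoherence F hij)
    refine Real.arccos_le_arccos ?_
    cases s <;> cases t <;> simp [hF] <;> linarith [h.1, h.2]

lemma coherenceBound_le_worstCaseCoherence {M N : ℕ} (hM : 2 ≤ M)
    {F : Fin N → EuclideanSpace ℝ (Fin M)} (hF : IsUnitNormFrame F) :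
    coherenceBound M N ≤ worstCaseCoherence F := by
  obtain ⟨n, rfl⟩ := Nat.exists_eq_add_of_le' hM
  have hpi := Real.pi_pos
  have hN : n + 2 ≤ N := by simpa using hF.1.finrank_le_card
  have hN' : (n : ℝ) + 2 ≤ N := by exact_mod_cast hN
  have hN0 : (0 : ℝ) < N := by linarith [(n.cast_nonneg : (0 : ℝ) ≤ n)]
  rw [coherenceBound_add_two]
  set w := ∫ φ in (0 : ℝ)..Real.pi, Real.sin φ ^ n with hw
  have hw0 : 0 < w := integral_sin_pow_pos n
  have hw1 : w ≤ Real.pi := integral_sin_pow_le_pi n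
  set x := ((n : ℝ) + 1) / (N * Real.pi) * w with hx
  have hx0 : 0 ≤ x := by positivity
  -- Here N ≥ M enters: it keeps the angle π x^(1/(n+1)) within [0, π], where cosine is decreasing.
  have hx1 : x ≤ 1 := by
    rw [hx, div_mul_eq_mul_div, div_le_one (by positivity)]
    gcongr
    linarith
  set c := worstCaseCoherence F
  set r := Real.arccos c / 2 with hr
  have hr0 : 0 ≤ r := by have := Real.arccos_nonneg c; positivity
  have hr1 : r ≤ Real.pi / 2 := by have := Real.arccos_le_pi c; linarith
  -- If c ≥ 1 the bound is trivial; otherwise cos (arccos c) = c.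
  rcases le_total 1 c with hc | hc
  · exact (Real.cos_le_one _).trans hc
  have hpack := card_mul_integral_sin_pow_le (V := EuclideanSpace ℝ (Fin (n + 2))) (n := n)
    (by simp) (u := fun p : Fin N × Bool => cond p.2 (F p.1) (-F p.1))
    (by rintro ⟨i, _ | _⟩ <;> simp [hF.2]) hr0 (by linarith) (fun p q hpq => by
      rw [hr, mul_div_cancel₀ _ two_ne_zero]
      exact arccos_worstCaseCoherence_le_angle hF.2 p q hpq)
  have hlow := le_integral_sin_pow n hr0 hr1
  simp only [Fintype.card_prod, Fintype.card_fin, Fintype.card_bool, Nat.cast_mul,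
    Nat.cast_ofNat] at hpack
  -- The factor 2 from the signs ± absorbs the mismatch between the n Jordan factors 2/π and the
  -- power n + 1.
  have hmain : (2 * r / Real.pi) ^ (n + 1) ≤ x := by
    have h1 : (2 * r / Real.pi) ^ (n + 1) = ((n : ℝ) + 1) / (N * Real.pi) *
        (N * 2 * ((2 / Real.pi) ^ n * (r ^ (n + 1) / (n + 1)))) := by
      clear_value r
      simp only [div_pow, mul_pow, pow_succ]
      field_simp
    rw [h1, hx]
    gcongr
    exact (mul_le_mul_of_nonneg_left hlow (by positivity)).trans hpack
  have hangle : Real.arccos c ≤ Real.pi * x ^ (1 / ((n : ℝ) + 1)) := by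
    have h2 : 2 * r / Real.pi ≤ x ^ (1 / ((n : ℝ) + 1)) := by
      rw [← Real.pow_rpow_inv_natCast (x := 2 * r / Real.pi) (by positivity) n.succ_ne_zero,
        one_div, Nat.cast_succ]
      exact Real.rpow_le_rpow (by positivity) hmain (by positivity)
    rw [div_le_iff₀ hpi] at h2
    linarith
  calc Real.cos (Real.pi * x ^ (1 / ((n : ℝ) + 1))) ≤ Real.cos (Real.arccos c) :=
        Real.cos_le_cos_of_nonneg_of_le_pi (Real.arccos_nonneg c)
          (mul_le_of_le_one_right hpi.le (Real.rpow_le_one hx0 hx1 (by positivity))) hangle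
    _ = c := Real.cos_arccos (by linarith [worstCaseCoherence_nonneg F]) hc

/-! ### The limit along N = Θ(a^M) -/

lemma tendsto_const_rpow_one_div_add_one {d : ℝ} (hd : 0 < d) :
    Tendsto (fun n : ℕ => d ^ (1 / ((n : ℝ) + 1))) atTop (𝓝 1) := by
  simpa using (tendsto_const_nhds (x := d)).rpow tendsto_one_div_add_atTop_nhds_zero_nat
    (Or.inl hd.ne')

/-- Squeeze: eventually the base of the root lies between a^(-(n+1))/(Caπ) and (n+1)(D/a)a^(-(n+1)),
and the (n+1)-th roots of both tend to 1/a. -/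
lemma tendsto_coherenceBound {a : ℝ} (ha : 0 < a) {N : ℕ → ℕ}
    (hN : (fun M : ℕ => (N M : ℝ)) =Θ[atTop] (fun M : ℕ => a ^ M)) :
    Tendsto (fun M : ℕ => coherenceBound M (N M)) atTop (𝓝 (Real.cos (Real.pi / a))) := by
  have hpi := Real.pi_pos
  obtain ⟨C, hC, hNC⟩ := hN.1.exists_pos
  obtain ⟨D, hD, hND⟩ := hN.2.exists_pos
  rw [← tendsto_add_atTop_iff_nat 2]
  simp only [coherenceBound_add_two]
  refine (Real.continuous_cos.tendsto _).comp ?_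
  rw [div_eq_mul_inv]
  refine Tendsto.const_mul _ ?_
  have hroot : ∀ n : ℕ, ((a⁻¹) ^ (n + 1)) ^ (1 / ((n : ℝ) + 1)) = a⁻¹ := fun n => by
    rw [one_div]
    exact_mod_cast Real.pow_rpow_inv_natCast (inv_nonneg.2 ha.le) n.succ_ne_zero
  have hlo : Tendsto (fun n : ℕ => (1 / (C * a * Real.pi)) ^ (1 / ((n : ℝ) + 1)) * a⁻¹)
      atTop (𝓝 a⁻¹) := by
    simpa using (tendsto_const_rpow_one_div_add_one
      (d := 1 / (C * a * Real.pi)) (by positivity)).mul_const a⁻¹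
  have hhi : Tendsto (fun n : ℕ => ((n : ℝ) + 1) ^ (1 / ((n : ℝ) + 1)) *
      (D / a) ^ (1 / ((n : ℝ) + 1)) * a⁻¹) atTop (𝓝 a⁻¹) := by
    -- This is x^(1/x) → 1 along x = n + 1.
    have h1 : Tendsto (fun n : ℕ => ((n : ℝ) + 1) ^ (1 / ((n : ℝ) + 1))) atTop (𝓝 1) :=
      tendsto_rpow_div.comp
        (tendsto_atTop_add_const_right _ 1 tendsto_natCast_atTop_atTop)
    simpa using (h1.mul (tendsto_const_rpow_one_div_add_one
      (d := D / a) (by positivity))).mul_const a⁻¹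
  have hev : ∀ᶠ n : ℕ in atTop, (N (n + 2) : ℝ) ≤ C * a ^ (n + 2) ∧
      a ^ (n + 2) ≤ D * N (n + 2) := by
    refine (tendsto_add_atTop_nat 2).eventually
      (p := fun M => (N M : ℝ) ≤ C * a ^ M ∧ a ^ M ≤ D * N M) ?_
    filter_upwards [hNC.bound, hND.bound] with M h1 h2
    rw [Real.norm_of_nonneg (by positivity), Real.norm_of_nonneg (by positivity)] at h1 h2
    exact ⟨h1, h2⟩
  refine tendsto_of_tendsto_of_tendsto_of_le_of_le' hlo hhi ?_ ?_
  · filter_upwards [hev] with n hn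
    -- The lower Θ-bound excludes N = 0, where division would return 0.
    have hNpos : (0 : ℝ) < N (n + 2) :=
      pos_of_mul_pos_right ((pow_pos ha _).trans_le hn.2) hD.le
    have hw := one_div_add_one_le_integral_sin_pow n
    calc _ = (1 / (C * a * Real.pi) * a⁻¹ ^ (n + 1)) ^ (1 / ((n : ℝ) + 1)) := by
          rw [Real.mul_rpow (by positivity) (by positivity), hroot]
      _ ≤ _ := by
          refine Real.rpow_le_rpow (by positivity) ?_ (by positivity)
          calc 1 / (C * a * Real.pi) * a⁻¹ ^ (n + 1) =
                ((n : ℝ) + 1) / (C * a ^ (n + 2) * Real.pi) * (1 / ((n : ℝ) + 1)) := by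
                rw [inv_pow, pow_succ a (n + 1)]; field_simp
            _ ≤ _ := by
                gcongr
                exact hn.1
  · filter_upwards [hev] with n hn
    have hNpos : (0 : ℝ) < N (n + 2) :=
      pos_of_mul_pos_right ((pow_pos ha _).trans_le hn.2) hD.le
    have hw := integral_sin_pow_le_pi n
    have hw0 := integral_sin_pow_pos n
    calc _ ≤ (((n : ℝ) + 1) * (D / a) * a⁻¹ ^ (n + 1)) ^ (1 / ((n : ℝ) + 1)) := by
          refine Real.rpow_le_rpow (by positivity) ?_ (by positivity)
          calc _ ≤ ((n : ℝ) + 1) / (N (n + 2) * Real.pi) * Real.pi := by gcongr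
            _ = ((n : ℝ) + 1) / N (n + 2) := by field_simp
            _ ≤ ((n : ℝ) + 1) / (a ^ (n + 2) / D) := by
                gcongr
                rw [div_le_iff₀ hD]
                linarith [hn.2]
            _ = _ := by rw [inv_pow, pow_succ a (n + 1)]; field_simp
      _ = _ := by
          rw [Real.mul_rpow (by positivity) (by positivity),
            Real.mul_rpow (by positivity) (by positivity), hroot]

theorem theorem6 :
    (∀ (M N : ℕ), 2 ≤ M → ∀ F : Fin N → EuclideanSpace ℝ (Fin M), IsUnitNormFrame F →
      coherenceBound M N ≤ worstCaseCoherence F) ∧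
    (∀ a : ℝ, 0 < a → ∀ N : ℕ → ℕ,
      (fun M : ℕ => (N M : ℝ)) =Θ[atTop] (fun M : ℕ => a ^ M) →
      Tendsto (fun M : ℕ => coherenceBound M (N M)) atTop (𝓝 (Real.cos (Real.pi / a)))) :=
  ⟨fun _ _ hM _ hF => coherenceBound_le_worstCaseCoherence hM hF,
    fun _ ha _ hN => tendsto_coherenceBound ha hN⟩
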